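/- **Setting.** Let $G$ be the hexagonal (honeycomb) lattice graph, and let $\ell:E(G)\to\mathbb R_{\ge 0}$ be a length function. For vertices $i,j$ let $P_{\langle ij\rangle}$ be the infimum, over paths from $i$ to $j$, of the sum of the lengths of the edges of the path. Put $c_i=\sum_{k\sim i}P_{\langle ik\rangle}^{-1}$ and $d_i=\sum_{k\sim i}P_{\langle ik\rangle}^{-2}$. For $0<t<1$ let $D_{t,i}$ be the probability distribution on $V(G)$ with $D_{t,i}(i)=1-t$, $D_{t,i}(k)=\frac{P_{\langle ik\rangle}^{-2}}{d_i}\,t$ for $k\sim i$, and $0$ elsewhere. For an edge $\langle ij\rangle$ let $W_{\langle ij\rangle}(t)$ be the infimum of the total costs of transporting $D_{t,i}$ to $D_{t,j}$ by finitely many moves between neighbouring vertices, where moving an amount $q$ from $u$ to a neighbour $v$ costs $qP_{\langle uv\rangle}$. The Lin–Lu–Yau curvature and the tree-curvature of the edge are $$K_{\langle ij\rangle}=\lim_{t\to0^+}\frac1t\Bigl(1-\frac{W_{\langle ij\rangle}(t)}{P_{\langle ij\rangle}}\Bigr),\qquad K^T_{\langle ij\rangle}=-\frac1{P_{\langle ij\rangle}}\Bigl[\frac{c_i}{d_i}+\frac{c_j}{d_j}-\frac{2}{P_{\langle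 ij\rangle}}\Bigl(\frac1{d_i}+\frac1{d_j}\Bigr)\Bigr].$$ A finite region $\Sigma$ is a finite connected subgraph of $G$. Length functions are always assumed to be such that $P_{\langle ij\rangle}>0$ for every edge $\langle ij\rangle$ of $G$ with an endpoint in $V(\Sigma)$. Put $$S_\Sigma=\sum_{e\in E(\Sigma)}K_e,\qquad S_T=\sum_{e\in E(\Sigma)}K^T_e .$$ A boundary of $\Sigma$ is given by a set $V(\partial\Sigma)\subseteq V(\Sigma)$ containing every vertex of $\Sigma$ that has a neighbour outside $V(\Sigma)$; $E(\partial\Sigma)$ is the set of edges of $G$ with both endpoints in $V(\partial\Sigma)$, or with one endpoint in $V(\partial\Sigma)$ and the other outside $V(\Sigma)$. For $c>0$, the *strong constant boundary condition* with constant $c$ says that $\ell(e)=c$ for every $e\in E(\partial\Sigma)$ and for every edge $e$ of $G$ that is one or two edge steps away from $E(\partial\Sigma)$ (edges that share an endpoint are one step apart). **Theorem.** Let $\Sigma$ be a finite region of $G$. 1. For every length function as above, the limit defining $K_e$ exists for every $e\in E(\Sigma)$, and $S_\Sigma\ge S_T$. 2. Let $\partial\Sigma$ be a boundary of $\Sigma$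 such that every edge of $G$ with an endpoint in $V(\Sigma)\setminus V(\partial\Sigma)$ belongs to $E(\Sigma)$, and let $c>0$. Among all length functions satisfying the strong constant boundary condition with constant $c$, the action $S_\Sigma$ attains its minimum at each length function $\ell_0$ (of this kind) that is constant on $E(\Sigma)$; such length functions exist (for instance $\ell\equiv c$). Moreover, for such an $\ell_0$, $K_e=K^T_e$ for all $e\in E(\Sigma)$. -/

import Mathlib

open Filter Topology
open scoped NNReal

noncomputable section

namespace LinLuYau

variable {V : Type*}

/-! Edge lengths are functions `ℓ : Sym2 V → ℝ≥0`; only their values on edges of the graph are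
ever used. -/

/-- The geodesic edge length: the infimum over all walks from `i` to `j` of the total length
of the edges traversed. -/
def geodesic (G : SimpleGraph V) (ℓ : Sym2 V → ℝ≥0) (i j : V) : ℝ :=
  ⨅ p : G.Walk i j, (((p.edges.map ℓ).sum : ℝ≥0) : ℝ)

theorem geodesic_comm (G : SimpleGraph V) (ℓ : Sym2 V → ℝ≥0) (i j : V) :
    geodesic G ℓ i j = geodesic G ℓ j i := by
  refine Function.Surjective.iInf_congr (fun p : G.Walk i j => p.reverse)
    (fun p => ⟨p.reverse, p.reverse_reverse⟩) (fun p => ?_)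
  simp [SimpleGraph.Walk.edges_reverse, List.sum_reverse]

/-- `c_i`, the sum of the inverse geodesic lengths over the neighbours of `i`. -/
def invSum (G : SimpleGraph V) (ℓ : Sym2 V → ℝ≥0) (i : V) : ℝ :=
  ∑ᶠ k ∈ G.neighborSet i, 1 / geodesic G ℓ i k

/-- `d_i`, the sum of the inverse squared geodesic lengths over the neighbours of `i`. -/
def invSqSum (G : SimpleGraph V) (ℓ : Sym2 V → ℝ≥0) (i : V) : ℝ :=
  ∑ᶠ k ∈ G.neighborSet i, 1 / geodesic G ℓ i k ^ 2

open Classical in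
/-- The probability distribution `D_{t,i}`. -/
def stepDist (G : SimpleGraph V) (ℓ : Sym2 V → ℝ≥0) (t : ℝ) (i : V) : V → ℝ := fun k =>
  if G.Adj i k then (1 / geodesic G ℓ i k ^ 2) / invSqSum G ℓ i * t
  else if k = i then 1 - t
  else 0

/-- `q (u, v)` is the total amount of probability moved from `u` to its neighbour `v`;
these moves turn the distribution `μ` into the distribution `ν`. -/
structure IsTransport (G : SimpleGraph V) (μ ν : V → ℝ) (q : V × V →₀ ℝ) : Prop where
  nonneg : ∀ p, 0 ≤ q p
  adj : ∀ u v, q (u, v) ≠ 0 → G.Adj u v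
  balance : ∀ v, μ v + ∑ᶠ u, q (u, v) = ν v + ∑ᶠ w, q (v, w)

/-- The total of the neighbour transportation costs of `q`. -/
def cost (G : SimpleGraph V) (ℓ : Sym2 V → ℝ≥0) (q : V × V →₀ ℝ) : ℝ :=
  q.sum fun p a => a * geodesic G ℓ p.1 p.2

/-- The Wasserstein (transportation) cost between two distributions. -/
def wasserstein (G : SimpleGraph V) (ℓ : Sym2 V → ℝ≥0) (μ ν : V → ℝ) : ℝ :=
  sInf {C | ∃ q, IsTransport G μ ν q ∧ cost G ℓ q = C}

theorem wasserstein_comm (G : SimpleGraph V) (ℓ : Sym2 V → ℝ≥0) (μ ν : V → ℝ) :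
    wasserstein G ℓ μ ν = wasserstein G ℓ ν μ := by
  have key : ∀ μ ν : V → ℝ, ∀ q : V × V →₀ ℝ, IsTransport G μ ν q →
      ∃ r, IsTransport G ν μ r ∧ cost G ℓ r = cost G ℓ q := by
    intro μ ν q hq
    have hr : ∀ u v, (q.equivMapDomain (Equiv.prodComm V V)) (u, v) = q (v, u) := by
      intro u v
      simp [Finsupp.equivMapDomain_apply]
    refine ⟨q.equivMapDomain (Equiv.prodComm V V), ⟨?_, ?_, ?_⟩, ?_⟩
    · rintro ⟨u, v⟩
      rw [hr]
      exact hq.nonneg _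
    · intro u v h
      rw [hr] at h
      exact (hq.adj v u h).symm
    · intro v
      simp only [hr]
      exact (hq.balance v).symm
    · unfold cost
      rw [Finsupp.sum_equivMapDomain]
      refine Finsupp.sum_congr fun p _ => ?_
      simp [geodesic_comm G ℓ p.1 p.2]
  unfold wasserstein
  congr 1
  ext C
  constructor
  · rintro ⟨q, hq, rfl⟩
    exact key _ _ q hq
  · rintro ⟨q, hq, rfl⟩
    exact key _ _ q hq

/-- `K_{⟨ij⟩}(t) = 1 - W_{⟨ij⟩}(t) / P_{⟨ij⟩}`. -/
def curvatureAt (G : SimpleGraph V) (ℓ : Sym2 V → ℝ≥0) (t : ℝ) (i j : V) : ℝ :=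
  1 - wasserstein G ℓ (stepDist G ℓ t i) (stepDist G ℓ t j) / geodesic G ℓ i j

theorem curvatureAt_comm (G : SimpleGraph V) (ℓ : Sym2 V → ℝ≥0) (t : ℝ) (i j : V) :
    curvatureAt G ℓ t i j = curvatureAt G ℓ t j i := by
  unfold curvatureAt
  rw [wasserstein_comm, geodesic_comm]

/-- The Lin-Lu-Yau curvature of an edge: the limit of `K(t) / t` as `t → 0`, `t > 0`. -/
def curvature (G : SimpleGraph V) (ℓ : Sym2 V → ℝ≥0) : Sym2 V → ℝ :=
  Sym2.lift ⟨fun i j => limUnder (𝓝[>] (0 : ℝ)) fun t => 1 / t * curvatureAt G ℓ t i j,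
    fun i j => by simp only [curvatureAt_comm G ℓ _ i j]⟩

/-- The tree-curvature of an edge. -/
def treeCurvature (G : SimpleGraph V) (ℓ : Sym2 V → ℝ≥0) : Sym2 V → ℝ :=
  Sym2.lift ⟨fun i j => -(1 / geodesic G ℓ i j) *
      (invSum G ℓ i / invSqSum G ℓ i + invSum G ℓ j / invSqSum G ℓ j
        - 2 / geodesic G ℓ i j * (1 / invSqSum G ℓ i + 1 / invSqSum G ℓ j)),
    fun i j => by
      beta_reduce
      rw [geodesic_comm G ℓ i j]
      ring⟩

/-- The action `S_Σ` of a finite region, without boundary term. -/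
def action {G : SimpleGraph V} (R : G.Subgraph) (ℓ : Sym2 V → ℝ≥0) : ℝ :=
  ∑ᶠ e ∈ R.edgeSet, curvature G ℓ e

/-- The tree-action `S_T` of a finite region. -/
def treeAction {G : SimpleGraph V} (R : G.Subgraph) (ℓ : Sym2 V → ℝ≥0) : ℝ :=
  ∑ᶠ e ∈ R.edgeSet, treeCurvature G ℓ e

/-- Every edge of the ambient graph with an endpoint in the region has positive geodesic length,
so that the denominators in the curvatures of the edges of the region do not vanish. -/
def PositiveNear {G : SimpleGraph V} (R : G.Subgraph) (ℓ : Sym2 V → ℝ≥0) : Prop :=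
  ∀ i ∈ R.verts, ∀ j, G.Adj i j → 0 < geodesic G ℓ i j

/-- `B` can serve as the set `V(∂Σ)`: it consists of vertices of the region, among them all those
that have a neighbour outside the region. -/
def IsBoundary {G : SimpleGraph V} (R : G.Subgraph) (B : Set V) : Prop :=
  B ⊆ R.verts ∧ ∀ v ∈ R.verts, (∃ w, G.Adj v w ∧ w ∉ R.verts) → v ∈ B

/-- `E(∂Σ)`: edges with both endpoints in `V(∂Σ)`, or with one endpoint in `V(∂Σ)` and the other
outside the region. -/
def boundaryEdges {G : SimpleGraph V} (R : G.Subgraph) (B : Set V) : Set (Sym2 V) :=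
  {e | ∃ i j, e = s(i, j) ∧ G.Adj i j ∧ i ∈ B ∧ (j ∈ B ∨ j ∉ R.verts)}

/-- The edges of `G` that lie in `F` or share an endpoint with an edge in `F`, that is, the edges
at most one edge step away from a set `F` of edges. -/
def withinStep (G : SimpleGraph V) (F : Set (Sym2 V)) : Set (Sym2 V) :=
  {e | e ∈ G.edgeSet ∧ ∃ f ∈ F, ∃ v, v ∈ e ∧ v ∈ f}

/-- The strong constant boundary condition: all edges that are zero, one or two edge steps away
from `E(∂Σ)` have length `c`. -/
def StrongBoundary {G : SimpleGraph V} (R : G.Subgraph) (B : Set V) (c : ℝ≥0)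
    (ℓ : Sym2 V → ℝ≥0) : Prop :=
  ∀ e ∈ withinStep G (withinStep G (boundaryEdges R B)), ℓ e = c

/-- The bonds of the hexagonal lattice: there is one vertex of each of two kinds (`false`, `true`) per cell
`(x, y) ∈ ℤ²`; the vertex `(x, y, false)` is joined to `(x, y, true)`, `(x - 1, y, true)` and
`(x, y - 1, true)`. -/
def hexBond (u v : ℤ × ℤ × Bool) : Prop :=
  u.2.2 = false ∧ v.2.2 = true ∧
    ((v.1 = u.1 ∧ v.2.1 = u.2.1) ∨ (v.1 = u.1 - 1 ∧ v.2.1 = u.2.1) ∨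
      (v.1 = u.1 ∧ v.2.1 = u.2.1 - 1))

/-- The hexagonal lattice as a graph: every vertex has degree three, and the faces of its standard
planar drawing are hexagons. -/
def hexLattice : SimpleGraph (ℤ × ℤ × Bool) where
  Adj u v := hexBond u v ∨ hexBond v u
  symm := ⟨fun _ _ h => h.symm⟩
  loopless := ⟨fun u h => by
    rcases h with h | h <;> exact absurd (h.1.symm.trans h.2.1) (by decide)⟩

end LinLuYau

end

open LinLuYau

/-! Routing all mass through the edge `⟨ij⟩` is one admissible transport, and its cost is exactly `P
(1 - t K^T)` (`cost_treeFlow`). Hence the tree-curvature is at most `K(t)/t` for every small `t`.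
This quotient is antitone in `t` (`curvatureAt_antitone`) and bounded above
(`exists_curvatureAt_le`), so it converges as `t → 0+`, which gives the limit and `K ≥ K^T` edge by
edge.

For the minimum, the tree-action is regrouped by vertices. A vertex `v` of degree three with all its
edges in the region contributes `2 - c_v²/d_v`, which is at least `-1` by Cauchy–Schwarz, with
equality when the three lengths agree (`sum_endpointCurvature_nonneg`). At the remaining vertices
the boundary condition makes all lengths equal to `c`, so each incident edge contributes exactly
`-1/3`. Thus `S_Σ ≥ S_T ≥ -(2/3)|E(Σ)|` (`le_treeAction`).

The bound is attained at constant lengths because the tree transport is then optimal. Without cycles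
of length four, the outer neighbours of the two ends of an edge are `3c` apart
(`three_mul_le_geodesic`), and the distance to the outer neighbours of `j` is a Kantorovich
potential certifying `K ≤ -2/3 = K^T` (`curvature_eq_of_const`). The two extra edge steps of the
boundary condition fix the lengths that such short walks can meet. -/

namespace LinLuYau

section Graph

variable {V : Type*} {G : SimpleGraph V} {ℓ : Sym2 V → ℝ≥0} {i j : V} {t : ℝ}

/-! ### Geodesic lengths -/

/-- The total length of the edges traversed by a walk. -/
noncomputable def walkLength (ℓ : Sym2 V → ℝ≥0) {i j : V} (p : G.Walk i j) : ℝ :=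
  ((p.edges.map ℓ).sum : ℝ≥0)

theorem walkLength_nonneg {i j : V} (p : G.Walk i j) : 0 ≤ walkLength ℓ p := NNReal.coe_nonneg _

theorem walkLength_cons {i j k : V} (h : G.Adj i j) (p : G.Walk j k) :
    walkLength ℓ (SimpleGraph.Walk.cons h p) = ℓ s(i, j) + walkLength ℓ p := by
  simp [walkLength]

theorem walkLength_append {i j k : V} (p : G.Walk i j) (q : G.Walk j k) :
    walkLength ℓ (p.append q) = walkLength ℓ p + walkLength ℓ q := by
  simp [walkLength, SimpleGraph.Walk.edges_append]

theorem walkLength_reverse {i j : V} (p : G.Walk i j) :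
    walkLength ℓ p.reverse = walkLength ℓ p := by
  simp [walkLength, SimpleGraph.Walk.edges_reverse, List.sum_reverse]

theorem geodesic_le_walkLength {i j : V} (p : G.Walk i j) :
    geodesic G ℓ i j ≤ walkLength ℓ p :=
  ciInf_le ⟨0, by rintro _ ⟨q, rfl⟩; exact walkLength_nonneg q⟩ p

theorem geodesic_nonneg (i j : V) : 0 ≤ geodesic G ℓ i j :=
  Real.iInf_nonneg fun p => walkLength_nonneg p

theorem geodesic_self (i : V) : geodesic G ℓ i i = 0 :=
  le_antisymm (by simpa [walkLength] using
    geodesic_le_walkLength (ℓ := ℓ) (SimpleGraph.Walk.nil : G.Walk i i)) (geodesic_nonneg i i)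

theorem geodesic_le_length {i j : V} (h : G.Adj i j) : geodesic G ℓ i j ≤ ℓ s(i, j) := by
  simpa [walkLength] using geodesic_le_walkLength (ℓ := ℓ) h.toWalk

theorem le_geodesic {i j : V} (h : G.Reachable i j) {a : ℝ}
    (ha : ∀ p : G.Walk i j, a ≤ walkLength ℓ p) : a ≤ geodesic G ℓ i j := by
  have : Nonempty (G.Walk i j) := h
  exact le_ciInf ha

theorem geodesic_triangle {i j k : V} (hij : G.Reachable i j) (hjk : G.Reachable j k) :
    geodesic G ℓ i k ≤ geodesic G ℓ i j + geodesic G ℓ j k := by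
  have h1 : geodesic G ℓ i k - geodesic G ℓ j k ≤ geodesic G ℓ i j := by
    refine le_geodesic hij fun p => ?_
    have h2 : geodesic G ℓ i k - walkLength ℓ p ≤ geodesic G ℓ j k := by
      refine le_geodesic hjk fun q => ?_
      have := geodesic_le_walkLength (ℓ := ℓ) (p.append q)
      rw [walkLength_append] at this
      linarith
    linarith
  linarith

/-- This makes the distance to a fixed vertex an admissible potential in the duality bound, even on
a disconnected graph. -/
theorem geodesic_sub_geodesic_le {u v : V} (h : G.Adj u v) (w : V) :
    geodesic G ℓ u w - geodesic G ℓ v w ≤ geodesic G ℓ u v := by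
  by_cases hw : G.Reachable v w
  · linarith [geodesic_triangle (ℓ := ℓ) h.reachable hw]
  -- If `w` is unreachable, the infimum over the empty set of walks takes the default value 0.
  · have h1 : IsEmpty (G.Walk u w) := ⟨fun p => hw (h.symm.reachable.trans p.reachable)⟩
    have h2 : geodesic G ℓ u w = 0 := by
      unfold geodesic
      exact Real.iInf_of_isEmpty _
    linarith [geodesic_nonneg (G := G) (ℓ := ℓ) v w, geodesic_nonneg (G := G) (ℓ := ℓ) u v]

/-- If all edges at the starting vertex have length `c`, then a walk that ends elsewhere is at
least that long. -/
theorem le_walkLength_of_start {c : ℝ≥0} {u w : V} (hu : ∀ x, G.Adj u x → ℓ s(u, x) = c)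
    (huw : u ≠ w) (p : G.Walk u w) : (c : ℝ) ≤ walkLength ℓ p := by
  cases p with
  | nil => exact absurd rfl huw
  | cons h p =>
    rw [walkLength_cons, hu _ h]
    linarith [walkLength_nonneg (ℓ := ℓ) p]

theorem le_walkLength_of_end {c : ℝ≥0} {u w : V} (hw : ∀ x, G.Adj w x → ℓ s(w, x) = c)
    (huw : u ≠ w) (p : G.Walk u w) : (c : ℝ) ≤ walkLength ℓ p := by
  rw [← walkLength_reverse]
  exact le_walkLength_of_start hw huw.symm _

theorem geodesic_eq_of_start {c : ℝ≥0} {u w : V} (hu : ∀ x, G.Adj u x → ℓ s(u, x) = c)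
    (h : G.Adj u w) : geodesic G ℓ u w = c := by
  refine le_antisymm ?_ (le_geodesic h.reachable (le_walkLength_of_start hu h.ne))
  simpa [hu w h] using geodesic_le_length (ℓ := ℓ) h

/-! ### Flows -/

open Classical in
/-- The net amount that the moves `q` carry away from `v`. -/
noncomputable def divergence (q : V × V →₀ ℝ) (v : V) : ℝ :=
  q.sum fun p a => a * ((if v = p.1 then 1 else 0) - if v = p.2 then 1 else 0)

theorem divergence_add (q r : V × V →₀ ℝ) (v : V) :
    divergence (q + r) v = divergence q v + divergence r v :=
  Finsupp.sum_add_index' (by simp) (fun _ _ _ => add_mul _ _ _)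

theorem divergence_smul (a : ℝ) (q : V × V →₀ ℝ) (v : V) :
    divergence (a • q) v = a * divergence q v := by
  classical
  unfold divergence
  rw [Finsupp.sum_smul_index' (by simp), Finsupp.sum, Finsupp.sum, Finset.mul_sum]
  exact Finset.sum_congr rfl fun _ _ => by simp [mul_assoc]

open Classical in
theorem divergence_single (x y : V) (a : ℝ) (v : V) :
    divergence (Finsupp.single (x, y) a) v =
      a * ((if v = x then 1 else 0) - if v = y then 1 else 0) :=
  Finsupp.sum_single_index (by simp)

theorem cost_add (q r : V × V →₀ ℝ) : cost G ℓ (q + r) = cost G ℓ q + cost G ℓ r :=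
  Finsupp.sum_add_index' (by simp) (fun _ _ _ => add_mul _ _ _)

theorem cost_smul (a : ℝ) (q : V × V →₀ ℝ) : cost G ℓ (a • q) = a * cost G ℓ q := by
  unfold cost
  rw [Finsupp.sum_smul_index' (by simp), Finsupp.sum, Finsupp.sum, Finset.mul_sum]
  exact Finset.sum_congr rfl fun _ _ => by simp [mul_assoc]

theorem cost_single (x y : V) (a : ℝ) :
    cost G ℓ (Finsupp.single (x, y) a) = a * geodesic G ℓ x y :=
  Finsupp.sum_single_index (by simp)

theorem cost_zero : cost G ℓ 0 = 0 := Finsupp.sum_zero_index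

theorem cost_sum {ι : Type*} (s : Finset ι) (q : ι → V × V →₀ ℝ) :
    cost G ℓ (∑ k ∈ s, q k) = ∑ k ∈ s, cost G ℓ (q k) := by
  classical
  induction s using Finset.induction_on with
  | empty => simp [cost_zero]
  | insert a s ha ih => rw [Finset.sum_insert ha, Finset.sum_insert ha, cost_add, ih]

theorem finite_support_left (q : V × V →₀ ℝ) (v : V) :
    (Function.support fun w => q (v, w)).Finite := by
  refine (q.support.finite_toSet.image Prod.snd).subset fun w hw => ⟨(v, w), ?_, rfl⟩
  simpa using hw

theorem finite_support_right (q : V × V →₀ ℝ) (v : V) :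
    (Function.support fun u => q (u, v)).Finite := by
  refine (q.support.finite_toSet.image Prod.fst).subset fun w hw => ⟨(w, v), ?_, rfl⟩
  simpa using hw

/-- Both sides are linear in `q`, so a single move suffices. This turns the balance equations into a
condition on the divergence, which behaves well under sums and scaling. -/
theorem finsum_sub_finsum_eq_divergence (q : V × V →₀ ℝ) (v : V) :
    (∑ᶠ w, q (v, w)) - ∑ᶠ u, q (u, v) = divergence q v := by
  classical
  induction q using Finsupp.induction_linear with
  | zero => simp [divergence]
  | add q r hq hr =>
    simp only [Finsupp.add_apply]
    rw [finsum_add_distrib (finite_support_left q v) (finite_support_left r v),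
      finsum_add_distrib (finite_support_right q v) (finite_support_right r v),
      divergence_add, ← hq, ← hr]
    ring
  | single p a =>
    obtain ⟨x, y⟩ := p
    rw [divergence_single, finsum_eq_single _ y, finsum_eq_single _ x]
    · simp only [Finsupp.single_apply, Prod.mk.injEq, and_true, true_and]
      by_cases h1 : v = x <;> by_cases h2 : v = y <;> simp [h1, h2, eq_comm] <;> simp_all [eq_comm]
    · intro u hu
      simp [hu.symm]
    · intro u hu
      simp [hu.symm]

/-- `q` describes moves between neighbours with net outflow `δ`. -/
structure IsFlow (G : SimpleGraph V) (δ : V → ℝ) (q : V × V →₀ ℝ) : Prop where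
  nonneg : ∀ p, 0 ≤ q p
  adj : ∀ u v, q (u, v) ≠ 0 → G.Adj u v
  divergence_eq : ∀ v, divergence q v = δ v

theorem isTransport_iff_isFlow {μ ν : V → ℝ} {q : V × V →₀ ℝ} :
    IsTransport G μ ν q ↔ IsFlow G (fun v => μ v - ν v) q := by
  refine ⟨fun h => ⟨h.nonneg, h.adj, fun v => ?_⟩, fun h => ⟨h.nonneg, h.adj, fun v => ?_⟩⟩
  · rw [← finsum_sub_finsum_eq_divergence]
    linarith [h.balance v]
  · have := h.divergence_eq v
    rw [← finsum_sub_finsum_eq_divergence] at this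
    linarith

theorem IsFlow.congr {δ δ' : V → ℝ} {q : V × V →₀ ℝ} (h : IsFlow G δ q) (hδ : ∀ v, δ v = δ' v) :
    IsFlow G δ' q :=
  ⟨h.nonneg, h.adj, fun v => (h.divergence_eq v).trans (hδ v)⟩

theorem IsFlow.add {δ ε : V → ℝ} {q r : V × V →₀ ℝ} (hq : IsFlow G δ q) (hr : IsFlow G ε r) :
    IsFlow G (fun v => δ v + ε v) (q + r) := by
  refine ⟨fun p => add_nonneg (hq.nonneg p) (hr.nonneg p), fun u v h => ?_, fun v => ?_⟩
  · by_contra hadj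
    refine h ?_
    rw [Finsupp.add_apply, not_not.1 (mt (hq.adj u v) hadj), not_not.1 (mt (hr.adj u v) hadj),
      add_zero]
  · rw [divergence_add, hq.divergence_eq, hr.divergence_eq]

theorem IsFlow.smul {δ : V → ℝ} {q : V × V →₀ ℝ} (hq : IsFlow G δ q) {a : ℝ} (ha : 0 ≤ a) :
    IsFlow G (fun v => a * δ v) (a • q) := by
  refine ⟨fun p => mul_nonneg ha (hq.nonneg p), fun u v h => hq.adj u v fun h0 => h ?_,
    fun v => ?_⟩
  · simp [h0]
  · rw [divergence_smul, hq.divergence_eq]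

open Classical in
theorem isFlow_single {x y : V} (h : G.Adj x y) {a : ℝ} (ha : 0 ≤ a) :
    IsFlow G (fun v => a * ((if v = x then 1 else 0) - if v = y then 1 else 0))
      (Finsupp.single (x, y) a) := by
  refine ⟨fun p => ?_, fun u v huv => ?_, divergence_single x y a⟩
  · rw [Finsupp.single_apply]
    split_ifs <;> simp [ha]
  · rw [Finsupp.single_apply] at huv
    have h1 := (ite_ne_right_iff.1 huv).1
    simp only [Prod.mk.injEq] at h1
    rwa [← h1.1, ← h1.2]

theorem IsFlow.sum {ι : Type*} (s : Finset ι) {δ : ι → V → ℝ} {q : ι → V × V →₀ ℝ}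
    (h : ∀ k ∈ s, IsFlow G (δ k) (q k)) :
    IsFlow G (fun v => ∑ k ∈ s, δ k v) (∑ k ∈ s, q k) := by
  classical
  induction s using Finset.induction_on with
  | empty => exact ⟨fun _ => le_rfl, fun _ _ h => absurd rfl h, fun _ => by simp [divergence]⟩
  | insert a s ha ih =>
    rw [Finset.sum_insert ha]
    refine ((h a (Finset.mem_insert_self a s)).add
      (ih fun k hk => h k (Finset.mem_insert_of_mem hk))).congr fun v => ?_
    rw [Finset.sum_insert ha]

/-- Weak duality: a potential that is 1-Lipschitz along edges bounds the cost of a flow from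
below. -/
theorem IsFlow.sum_mul_le_cost {δ : V → ℝ} {q : V × V →₀ ℝ} (hq : IsFlow G δ q) {f : V → ℝ}
    (hf : ∀ u v, G.Adj u v → f u - f v ≤ geodesic G ℓ u v) {T : Finset V}
    (hT : ∀ v, v ∉ T → δ v = 0) : ∑ v ∈ T, f v * δ v ≤ cost G ℓ q := by
  classical
  -- Enlarging `T` by the endpoints of all moves lets both indicator sums below collapse after the
  -- order of summation is exchanged.
  set S := T ∪ q.support.image Prod.fst ∪ q.support.image Prod.snd with hS
  have h1 : ∑ v ∈ T, f v * δ v = ∑ v ∈ S, f v * divergence q v := by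
    rw [Finset.sum_subset (show T ⊆ S from fun v hv => by simp [hS, hv])
      (fun v _ hv => by rw [hT v hv, mul_zero])]
    exact Finset.sum_congr rfl fun v _ => by rw [hq.divergence_eq]
  have h2 : ∑ v ∈ S, f v * divergence q v = ∑ p ∈ q.support, q p * (f p.1 - f p.2) := by
    simp only [divergence, Finsupp.sum, Finset.mul_sum]
    rw [Finset.sum_comm]
    refine Finset.sum_congr rfl fun p hp => ?_
    have hp1 : p.1 ∈ S :=
      Finset.mem_union_left _ (Finset.mem_union_right _ (Finset.mem_image_of_mem _ hp))
    have hp2 : p.2 ∈ S := Finset.mem_union_right _ (Finset.mem_image_of_mem _ hp)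
    calc ∑ v ∈ S, f v * (q p * ((if v = p.1 then 1 else 0) - if v = p.2 then 1 else 0))
        = q p * (∑ v ∈ S, f v * (if v = p.1 then 1 else 0)
            - ∑ v ∈ S, f v * (if v = p.2 then 1 else 0)) := by
          rw [← Finset.sum_sub_distrib, Finset.mul_sum]
          exact Finset.sum_congr rfl fun v _ => by ring
      _ = q p * (f p.1 - f p.2) := by simp [hp1, hp2]
  rw [h1, h2, cost, Finsupp.sum]
  refine Finset.sum_le_sum fun p hp => mul_le_mul_of_nonneg_left ?_ (hq.nonneg p)
  exact hf _ _ (hq.adj p.1 p.2 (Finsupp.mem_support_iff.1 hp))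

theorem IsFlow.cost_nonneg {δ : V → ℝ} {q : V × V →₀ ℝ} (hq : IsFlow G δ q) :
    0 ≤ cost G ℓ q :=
  Finset.sum_nonneg fun p _ => mul_nonneg (hq.nonneg p) (geodesic_nonneg _ _)

theorem wasserstein_le_cost {μ ν : V → ℝ} {q : V × V →₀ ℝ}
    (hq : IsFlow G (fun v => μ v - ν v) q) : wasserstein G ℓ μ ν ≤ cost G ℓ q := by
  refine csInf_le ⟨0, ?_⟩ ⟨q, isTransport_iff_isFlow.2 hq, rfl⟩
  rintro _ ⟨r, hr, rfl⟩
  exact (isTransport_iff_isFlow.1 hr).cost_nonneg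

/-- Some flow must exist, since the infimum of the empty set is 0 by default. -/
theorem le_wasserstein {μ ν : V → ℝ} (hne : ∃ q, IsFlow G (fun v => μ v - ν v) q) {a : ℝ}
    (ha : ∀ q, IsFlow G (fun v => μ v - ν v) q → a ≤ cost G ℓ q) : a ≤ wasserstein G ℓ μ ν := by
  obtain ⟨q, hq⟩ := hne
  refine le_csInf ⟨_, q, isTransport_iff_isFlow.2 hq, rfl⟩ ?_
  rintro _ ⟨r, hr, rfl⟩
  exact ha r (isTransport_iff_isFlow.1 hr)

/-! ### The distributions `D_{t,i}` -/

/-- The probability of the step from `i` to `k`, given that a step is made. -/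
noncomputable def stepWeight (G : SimpleGraph V) (ℓ : Sym2 V → ℝ≥0) (i k : V) : ℝ :=
  (1 / geodesic G ℓ i k ^ 2) / invSqSum G ℓ i

theorem invSqSum_nonneg : 0 ≤ invSqSum G ℓ i :=
  finsum_nonneg fun _ => finsum_nonneg fun _ => by positivity

theorem stepWeight_nonneg (k : V) : 0 ≤ stepWeight G ℓ i k :=
  div_nonneg (by positivity) invSqSum_nonneg

section LocallyFinite

variable [G.LocallyFinite]

theorem invSum_eq_sum (i : V) :
    invSum G ℓ i = ∑ k ∈ G.neighborFinset i, 1 / geodesic G ℓ i k := by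
  rw [invSum, ← SimpleGraph.coe_neighborFinset, finsum_mem_coe_finset]

theorem invSqSum_eq_sum (i : V) :
    invSqSum G ℓ i = ∑ k ∈ G.neighborFinset i, 1 / geodesic G ℓ i k ^ 2 := by
  rw [invSqSum, ← SimpleGraph.coe_neighborFinset, finsum_mem_coe_finset]

theorem invSqSum_pos (hi : ∀ k, G.Adj i k → 0 < geodesic G ℓ i k) (h : G.Adj i j) :
    0 < invSqSum G ℓ i := by
  rw [invSqSum_eq_sum]
  refine Finset.sum_pos (fun k hk => ?_) ⟨j, by simpa using h⟩
  have := hi k (by simpa using hk)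
  positivity

theorem sum_stepWeight (hi : ∀ k, G.Adj i k → 0 < geodesic G ℓ i k) (h : G.Adj i j) :
    ∑ k ∈ G.neighborFinset i, stepWeight G ℓ i k = 1 := by
  simp only [stepWeight]
  rw [← Finset.sum_div, ← invSqSum_eq_sum, div_self (invSqSum_pos hi h).ne']

open Classical in
theorem sum_erase_stepWeight (hi : ∀ k, G.Adj i k → 0 < geodesic G ℓ i k) (h : G.Adj i j) :
    ∑ k ∈ (G.neighborFinset i).erase j, stepWeight G ℓ i k = 1 - stepWeight G ℓ i j := by
  rw [Finset.sum_erase_eq_sub (by simpa using h), sum_stepWeight hi h]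

theorem stepWeight_le_one (hi : ∀ k, G.Adj i k → 0 < geodesic G ℓ i k) (h : G.Adj i j) :
    stepWeight G ℓ i j ≤ 1 := by
  classical
  have := sum_erase_stepWeight hi h
  have h2 : 0 ≤ ∑ k ∈ (G.neighborFinset i).erase j, stepWeight G ℓ i k :=
    Finset.sum_nonneg fun k _ => stepWeight_nonneg k
  linarith

-- Writing the distribution as a combination of point masses shows that it is affine in `t`, the
-- source of the monotonicity of `K(t)/t`.
open Classical in
theorem stepDist_eq (t : ℝ) (i v : V) :
    stepDist G ℓ t i v = (1 - t) * (if v = i then 1 else 0)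
      + t * ∑ k ∈ G.neighborFinset i, stepWeight G ℓ i k * if v = k then 1 else 0 := by
  have : ∑ k ∈ G.neighborFinset i, stepWeight G ℓ i k * (if v = k then 1 else 0)
      = if G.Adj i v then stepWeight G ℓ i v else 0 := by
    simp [Finset.sum_ite_eq]
  rw [this, stepDist]
  by_cases h : G.Adj i v
  · simp [h, h.ne', stepWeight, mul_comm]
  · simp [h]

open Classical in
theorem stepDist_eq_erase (t : ℝ) (h : G.Adj i j) (v : V) :
    stepDist G ℓ t i v = (1 - t) * (if v = i then 1 else 0)
      + t * (stepWeight G ℓ i j * (if v = j then 1 else 0)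
        + ∑ k ∈ (G.neighborFinset i).erase j, stepWeight G ℓ i k * if v = k then 1 else 0) := by
  rw [stepDist_eq, Finset.add_sum_erase _ (fun k => stepWeight G ℓ i k * if v = k then 1 else 0)
    (show j ∈ G.neighborFinset i by simpa using h)]

theorem sum_mul_stepDist (f : V → ℝ) (t : ℝ) (i : V) {T : Finset V} (hi : i ∈ T)
    (hT : G.neighborFinset i ⊆ T) :
    ∑ v ∈ T, f v * stepDist G ℓ t i v
      = (1 - t) * f i + t * ∑ k ∈ G.neighborFinset i, stepWeight G ℓ i k * f k := by
  classical
  simp only [stepDist_eq, mul_add, Finset.sum_add_distrib]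
  congr 1
  · simp [hi, mul_comm]
  · simp only [Finset.mul_sum]
    rw [Finset.sum_comm]
    refine Finset.sum_congr rfl fun k hk => ?_
    have hkT := hT hk
    simp [hkT]
    ring

/-- Kantorovich's lower bound for the transportation cost between `D_{t,i}` and `D_{t,j}`. -/
theorem potential_le_cost {f : V → ℝ}
    (hf : ∀ u v, G.Adj u v → f u - f v ≤ geodesic G ℓ u v) {q : V × V →₀ ℝ}
    (hq : IsFlow G (fun v => stepDist G ℓ t i v - stepDist G ℓ t j v) q) :
    (1 - t) * (f i - f j) + t * (∑ k ∈ G.neighborFinset i, stepWeight G ℓ i k * f k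
      - ∑ k ∈ G.neighborFinset j, stepWeight G ℓ j k * f k) ≤ cost G ℓ q := by
  classical
  set T : Finset V := insert i (insert j (G.neighborFinset i ∪ G.neighborFinset j)) with hT
  have key := hq.sum_mul_le_cost hf (T := T) (fun v hv => by
    simp only [hT, Finset.mem_insert, Finset.mem_union, SimpleGraph.mem_neighborFinset,
      not_or] at hv
    simp [stepDist, hv])
  simp only [mul_sub, Finset.sum_sub_distrib] at key
  rw [sum_mul_stepDist f t i (by simp [hT]) (fun v hv => by simp [hT] at hv ⊢; tauto),
    sum_mul_stepDist f t j (by simp [hT]) (fun v hv => by simp [hT] at hv ⊢; tauto)] at key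
  linarith

/-! ### The tree transport -/

open Classical in
/-- The transport from `D_{t,i}` to `D_{t,j}` in which all probability passes through the
edge `⟨ij⟩`. -/
noncomputable def treeFlow (G : SimpleGraph V) [G.LocallyFinite] (ℓ : Sym2 V → ℝ≥0) (t : ℝ)
    (i j : V) : V × V →₀ ℝ :=
  (∑ k ∈ (G.neighborFinset i).erase j, Finsupp.single (k, i) (t * stepWeight G ℓ i k))
    + Finsupp.single (i, j) (1 - t * (stepWeight G ℓ i j + stepWeight G ℓ j i))
    + ∑ k ∈ (G.neighborFinset j).erase i, Finsupp.single (j, k) (t * stepWeight G ℓ j k)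

/-- The amount sent along `⟨ij⟩` must be nonnegative. Both step weights are at most 1, so `t ≤ 1/2`
is enough. -/
theorem isFlow_treeFlow (hi : ∀ k, G.Adj i k → 0 < geodesic G ℓ i k)
    (hj : ∀ k, G.Adj j k → 0 < geodesic G ℓ j k) (h : G.Adj i j) (ht0 : 0 ≤ t) (ht : t ≤ 1 / 2) :
    IsFlow G (fun v => stepDist G ℓ t i v - stepDist G ℓ t j v) (treeFlow G ℓ t i j) := by
  classical
  have hwi := stepWeight_le_one hi h
  have hwj := stepWeight_le_one hj h.symm
  have h1 := IsFlow.sum ((G.neighborFinset i).erase j) fun k hk =>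
    isFlow_single (G := G) (x := k) (y := i) (a := t * stepWeight G ℓ i k)
      (by simp at hk; exact hk.2.symm) (mul_nonneg ht0 (stepWeight_nonneg k))
  have h2 := isFlow_single h (a := 1 - t * (stepWeight G ℓ i j + stepWeight G ℓ j i))
    (by nlinarith)
  have h3 := IsFlow.sum ((G.neighborFinset j).erase i) fun k hk =>
    isFlow_single (G := G) (x := j) (y := k) (a := t * stepWeight G ℓ j k)
      (by simp at hk; exact hk.2) (mul_nonneg ht0 (stepWeight_nonneg k))
  refine ((h1.add h2).add h3).congr fun v => ?_
  rw [stepDist_eq_erase t h, stepDist_eq_erase t h.symm]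
  simp only [mul_sub, Finset.sum_sub_distrib, mul_assoc, ← Finset.mul_sum]
  rw [← Finset.sum_mul, ← Finset.sum_mul, sum_erase_stepWeight hi h,
    sum_erase_stepWeight hj h.symm]
  ring

theorem sum_erase_stepWeight_mul_geodesic [DecidableEq V]
    (hi : ∀ k, G.Adj i k → 0 < geodesic G ℓ i k) (h : G.Adj i j) :
    ∑ k ∈ (G.neighborFinset i).erase j, stepWeight G ℓ i k * geodesic G ℓ i k
      = (invSum G ℓ i - 1 / geodesic G ℓ i j) / invSqSum G ℓ i := by
  rw [invSum_eq_sum, ← Finset.sum_erase_eq_sub (by simpa using h), Finset.sum_div]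
  refine Finset.sum_congr rfl fun k hk => ?_
  have := hi k (by simp at hk; exact hk.2)
  rw [stepWeight]
  field_simp

theorem cost_treeFlow (hi : ∀ k, G.Adj i k → 0 < geodesic G ℓ i k)
    (hj : ∀ k, G.Adj j k → 0 < geodesic G ℓ j k) (h : G.Adj i j) (t : ℝ) :
    cost G ℓ (treeFlow G ℓ t i j)
      = geodesic G ℓ i j * (1 - t * treeCurvature G ℓ s(i, j)) := by
  classical
  have hP := hi j h
  have hdi := (invSqSum_pos hi h).ne'
  have hdj := (invSqSum_pos hj h.symm).ne'
  rw [treeFlow, cost_add, cost_add, cost_sum, cost_sum]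
  simp only [cost_single, mul_assoc]
  simp only [← Finset.mul_sum]
  simp only [geodesic_comm G ℓ _ i]
  rw [sum_erase_stepWeight_mul_geodesic hi h, sum_erase_stepWeight_mul_geodesic hj h.symm,
    stepWeight, stepWeight, geodesic_comm G ℓ j i]
  simp only [treeCurvature, Sym2.lift_mk]
  field_simp
  ring

theorem treeCurvature_le (hi : ∀ k, G.Adj i k → 0 < geodesic G ℓ i k)
    (hj : ∀ k, G.Adj j k → 0 < geodesic G ℓ j k) (h : G.Adj i j) (ht0 : 0 < t) (ht : t ≤ 1 / 2) :
    treeCurvature G ℓ s(i, j) ≤ 1 / t * curvatureAt G ℓ t i j := by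
  have h1 := wasserstein_le_cost (ℓ := ℓ) (isFlow_treeFlow hi hj h ht0.le ht)
  rw [cost_treeFlow hi hj h] at h1
  have hP := hi j h
  rw [curvatureAt, one_div, ← div_eq_inv_mul, le_div_iff₀ ht0]
  have := (div_le_iff₀' hP).2 h1
  linarith

/-! ### Existence of the limit -/

theorem curvatureAt_le_of_potential (hi : ∀ k, G.Adj i k → 0 < geodesic G ℓ i k)
    (hj : ∀ k, G.Adj j k → 0 < geodesic G ℓ j k) (h : G.Adj i j) (ht0 : 0 < t) (ht : t ≤ 1 / 2)
    {a : ℝ} (ha : ∀ q, IsFlow G (fun v => stepDist G ℓ t i v - stepDist G ℓ t j v) q →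
      geodesic G ℓ i j * (1 - t * a) ≤ cost G ℓ q) :
    1 / t * curvatureAt G ℓ t i j ≤ a := by
  have h1 := le_wasserstein (ℓ := ℓ) ⟨_, isFlow_treeFlow hi hj h ht0.le ht⟩ ha
  have hP := hi j h
  rw [curvatureAt, one_div, ← div_eq_inv_mul, div_le_iff₀ ht0]
  have := (le_div_iff₀' hP).2 h1
  linarith

/-- For `s ≤ t`, the difference `D_{s,i} - D_{s,j}` is the convex combination, with weights `1 -
s/t` and `s/t`, of `δ_i - δ_j` and `D_{t,i} - D_{t,j}`. Combining the flows gives `W(s) ≤ (1 - s/t)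
P + (s/t) W(t)`, which rearranges to the claim. -/
theorem curvatureAt_antitone (hi : ∀ k, G.Adj i k → 0 < geodesic G ℓ i k)
    (hj : ∀ k, G.Adj j k → 0 < geodesic G ℓ j k) (h : G.Adj i j) {s : ℝ} (hs0 : 0 < s)
    (hst : s ≤ t) (ht : t ≤ 1 / 2) :
    1 / t * curvatureAt G ℓ t i j ≤ 1 / s * curvatureAt G ℓ s i j := by
  classical
  have ht0 := hs0.trans_le hst
  have hP := hi j h
  refine curvatureAt_le_of_potential hi hj h ht0 ht fun q hq => ?_
  have hst' : s / t ≤ 1 := (div_le_one ht0).2 hst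
  have hr := ((isFlow_single h (a := 1 - s / t) (by linarith)).add
    (hq.smul (a := s / t) (by positivity))).congr
      (δ' := fun v => stepDist G ℓ s i v - stepDist G ℓ s j v) (fun v => by
        simp only [stepDist_eq]
        field_simp
        ring)
  have h1 := wasserstein_le_cost (ℓ := ℓ) hr
  rw [cost_add, cost_smul, cost_single] at h1
  rw [curvatureAt]
  have e : geodesic G ℓ i j * (1 - t * (1 / s * (1 - wasserstein G ℓ (stepDist G ℓ s i)
      (stepDist G ℓ s j) / geodesic G ℓ i j)))
      = t / s * (wasserstein G ℓ (stepDist G ℓ s i) (stepDist G ℓ s j)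
        - (1 - s / t) * geodesic G ℓ i j) := by
    field_simp
    ring
  rw [e]
  calc _ ≤ t / s * (s / t * cost G ℓ q) := by
        refine mul_le_mul_of_nonneg_left ?_ (by positivity)
        linarith
    _ = cost G ℓ q := by field_simp

/-- The potential "distance to `j`" drops by exactly `P` from `i` to `j`, so its dual bound has the
form `P (1 - t a)` with `a` independent of `t`. -/
theorem exists_curvatureAt_le (hi : ∀ k, G.Adj i k → 0 < geodesic G ℓ i k)
    (hj : ∀ k, G.Adj j k → 0 < geodesic G ℓ j k) (h : G.Adj i j) :
    ∃ a, ∀ t, 0 < t → t ≤ 1 / 2 → 1 / t * curvatureAt G ℓ t i j ≤ a := by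
  have hP := hi j h
  refine ⟨1 - (∑ k ∈ G.neighborFinset i, stepWeight G ℓ i k * geodesic G ℓ k j
      - ∑ k ∈ G.neighborFinset j, stepWeight G ℓ j k * geodesic G ℓ k j) / geodesic G ℓ i j,
    fun t ht0 ht => curvatureAt_le_of_potential hi hj h ht0 ht fun q hq => ?_⟩
  refine le_of_eq_of_le ?_
    (potential_le_cost (f := fun v => geodesic G ℓ v j)
      (fun u v huv => geodesic_sub_geodesic_le huv j) hq)
  simp only [geodesic_self]
  field_simp
  ring

theorem tendsto_curvatureAt (hi : ∀ k, G.Adj i k → 0 < geodesic G ℓ i k)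
    (hj : ∀ k, G.Adj j k → 0 < geodesic G ℓ j k) (h : G.Adj i j) :
    Tendsto (fun t : ℝ => 1 / t * curvatureAt G ℓ t i j) (𝓝[>] 0)
      (𝓝 (curvature G ℓ s(i, j))) := by
  obtain ⟨a, ha⟩ := exists_curvatureAt_le hi hj h
  -- `limUnder` is the limit once some limit exists; monotone convergence provides one.
  refine tendsto_nhds_limUnder ?_
  have hmono : MonotoneOn (fun t : ℝ => -(1 / t * curvatureAt G ℓ t i j))
      (Set.Ioo (0 : ℝ) (1 / 2)) := fun s hs t ht hst =>
    neg_le_neg (curvatureAt_antitone hi hj h hs.1 hst ht.2.le)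
  have hlim := hmono.tendsto_nhdsWithin_Ioo_right (by norm_num)
    ⟨-a, by rintro _ ⟨t, ht, rfl⟩; exact neg_le_neg (ha t ht.1 ht.2.le)⟩
  exact ⟨_, by simpa using hlim.neg⟩

theorem eventually_nhdsGT_zero_le_half : ∀ᶠ t : ℝ in 𝓝[>] 0, 0 < t ∧ t ≤ 1 / 2 := by
  filter_upwards [Ioo_mem_nhdsGT (show (0 : ℝ) < 1 / 2 by norm_num)] with t ht
  exact ⟨ht.1, ht.2.le⟩

theorem treeCurvature_le_curvature (hi : ∀ k, G.Adj i k → 0 < geodesic G ℓ i k)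
    (hj : ∀ k, G.Adj j k → 0 < geodesic G ℓ j k) (h : G.Adj i j) :
    treeCurvature G ℓ s(i, j) ≤ curvature G ℓ s(i, j) := by
  refine ge_of_tendsto (tendsto_curvatureAt hi hj h) ?_
  filter_upwards [eventually_nhdsGT_zero_le_half] with t ht
  exact treeCurvature_le hi hj h ht.1 ht.2

theorem curvature_le (hi : ∀ k, G.Adj i k → 0 < geodesic G ℓ i k)
    (hj : ∀ k, G.Adj j k → 0 < geodesic G ℓ j k) (h : G.Adj i j) {a : ℝ}
    (ha : ∀ t, 0 < t → t ≤ 1 / 2 →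
      ∀ q, IsFlow G (fun v => stepDist G ℓ t i v - stepDist G ℓ t j v) q →
        geodesic G ℓ i j * (1 - t * a) ≤ cost G ℓ q) :
    curvature G ℓ s(i, j) ≤ a := by
  refine le_of_tendsto (tendsto_curvatureAt hi hj h) ?_
  filter_upwards [eventually_nhdsGT_zero_le_half] with t ht
  exact curvatureAt_le_of_potential hi hj h ht.1 ht.2 (ha t ht.1 ht.2)

end LocallyFinite

/-! ### Contributions of the endpoints of an edge -/

/-- The geodesic length of an edge. -/
noncomputable def edgeGeodesic (G : SimpleGraph V) (ℓ : Sym2 V → ℝ≥0) : Sym2 V → ℝ :=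
  Sym2.lift ⟨geodesic G ℓ, geodesic_comm G ℓ⟩

/-- The contribution of the endpoint `v` to the tree-curvature of the edge `e`. -/
noncomputable def endpointCurvature (G : SimpleGraph V) (ℓ : Sym2 V → ℝ≥0) (v : V) (e : Sym2 V) :
    ℝ :=
  2 * (1 / edgeGeodesic G ℓ e) ^ 2 / invSqSum G ℓ v
    - 1 / edgeGeodesic G ℓ e * invSum G ℓ v / invSqSum G ℓ v

/-- Each summand involves only the lengths around one endpoint, so the tree-action can be regrouped
by vertices. -/
theorem treeCurvature_eq_add (i j : V) :
    treeCurvature G ℓ s(i, j)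
      = endpointCurvature G ℓ i s(i, j) + endpointCurvature G ℓ j s(i, j) := by
  simp only [treeCurvature, endpointCurvature, edgeGeodesic, Sym2.lift_mk]
  ring

theorem finite_edgeSet_of_finite_verts {R : G.Subgraph} (hfin : R.verts.Finite) :
    R.edgeSet.Finite := by
  refine ((hfin.prod hfin).image fun p => s(p.1, p.2)).subset fun e he => ?_
  induction e with
  | h a b =>
    rw [SimpleGraph.Subgraph.mem_edgeSet] at he
    exact ⟨(a, b), ⟨he.fst_mem, he.snd_mem⟩, rfl⟩

/-! ### Constant geodesic lengths -/

section LocallyFinite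

variable [G.LocallyFinite]

theorem invSum_eq_of_const {c : ℝ} (hi : ∀ k, G.Adj i k → geodesic G ℓ i k = c) :
    invSum G ℓ i = G.degree i * (1 / c) := by
  rw [invSum_eq_sum, Finset.sum_congr rfl fun k hk => by rw [hi k (by simpa using hk)],
    Finset.sum_const, SimpleGraph.card_neighborFinset_eq_degree, nsmul_eq_mul]

theorem invSqSum_eq_of_const {c : ℝ} (hi : ∀ k, G.Adj i k → geodesic G ℓ i k = c) :
    invSqSum G ℓ i = G.degree i * (1 / c ^ 2) := by
  rw [invSqSum_eq_sum, Finset.sum_congr rfl fun k hk => by rw [hi k (by simpa using hk)],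
    Finset.sum_const, SimpleGraph.card_neighborFinset_eq_degree, nsmul_eq_mul]

theorem stepWeight_eq_of_const {c : ℝ} (hc : 0 < c) (hdeg : G.degree i = 3)
    (hi : ∀ k, G.Adj i k → geodesic G ℓ i k = c) (h : G.Adj i j) :
    stepWeight G ℓ i j = 1 / 3 := by
  rw [stepWeight, invSqSum_eq_of_const hi, hi j h, hdeg]
  push_cast
  field_simp

theorem treeCurvature_eq_of_const {c : ℝ} (hc : 0 < c) (hdi : G.degree i = 3)
    (hdj : G.degree j = 3) (hi : ∀ k, G.Adj i k → geodesic G ℓ i k = c)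
    (hj : ∀ k, G.Adj j k → geodesic G ℓ j k = c) (h : G.Adj i j) :
    treeCurvature G ℓ s(i, j) = -(2 / 3) := by
  simp only [treeCurvature, Sym2.lift_mk]
  rw [invSum_eq_of_const hi, invSum_eq_of_const hj, invSqSum_eq_of_const hi,
    invSqSum_eq_of_const hj, hdi, hdj, hi j h]
  push_cast
  field_simp
  norm_num

theorem curvature_eq_of_const {c : ℝ} (hc : 0 < c) (hdi : G.degree i = 3)
    (hdj : G.degree j = 3) (hi : ∀ k, G.Adj i k → geodesic G ℓ i k = c)
    (hj : ∀ k, G.Adj j k → geodesic G ℓ j k = c) (h : G.Adj i j)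
    (hfar : ∀ k k', G.Adj i k → k ≠ j → G.Adj j k' → k' ≠ i → 3 * c ≤ geodesic G ℓ k k') :
    curvature G ℓ s(i, j) = treeCurvature G ℓ s(i, j) := by
  classical
  have hi0 : ∀ k, G.Adj i k → 0 < geodesic G ℓ i k := fun k hk => by rwa [hi k hk]
  have hj0 : ∀ k, G.Adj j k → 0 < geodesic G ℓ j k := fun k hk => by rwa [hj k hk]
  refine le_antisymm ?_ (treeCurvature_le_curvature hi0 hj0 h)
  rw [treeCurvature_eq_of_const hc hdi hdj hi hj h]
  have hjN : j ∈ G.neighborFinset i := by simpa using h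
  have hiN : i ∈ G.neighborFinset j := by simpa using h.symm
  have hcardi : ((G.neighborFinset i).erase j).card = 2 := by
    rw [Finset.card_erase_of_mem hjN, SimpleGraph.card_neighborFinset_eq_degree, hdi]
  have hcardj : ((G.neighborFinset j).erase i).card = 2 := by
    rw [Finset.card_erase_of_mem hiN, SimpleGraph.card_neighborFinset_eq_degree, hdj]
  set S := (G.neighborFinset j).erase i with hS
  have hSne : S.Nonempty := Finset.card_pos.1 (by omega)
  -- The dual potential: distance to the set of neighbours of `j` other than `i`. It vanishes on
  -- that set, is at least `3c` at the outer neighbours of `i`, and hence is at least `2c` at `i`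
  -- and at most `c` at `j`.
  set F : V → ℝ := fun v => S.inf' hSne fun k' => geodesic G ℓ v k' with hF
  have hlip : ∀ u v, G.Adj u v → F u - F v ≤ geodesic G ℓ u v := fun u v huv => by
    obtain ⟨k', hk', e⟩ := S.exists_mem_eq_inf' hSne fun k' => geodesic G ℓ v k'
    have h1 : F u ≤ geodesic G ℓ u k' := Finset.inf'_le _ hk'
    have h2 : F v = geodesic G ℓ v k' := e
    linarith [geodesic_sub_geodesic_le (ℓ := ℓ) huv k']
  have hFS : ∀ k ∈ S, F k = 0 := fun k hk => by
    refine le_antisymm ((Finset.inf'_le _ hk).trans_eq (geodesic_self k)) ?_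
    exact Finset.le_inf' _ _ fun k' _ => geodesic_nonneg _ _
  have hFfar : ∀ k ∈ (G.neighborFinset i).erase j, 3 * c ≤ F k := fun k hk => by
    refine Finset.le_inf' _ _ fun k' hk' => ?_
    simp only [hS, Finset.mem_erase, SimpleGraph.mem_neighborFinset] at hk hk'
    exact hfar k k' hk.2 hk.1 hk'.2 hk'.1
  have hFij : c ≤ F i - F j := by
    obtain ⟨k', hk'⟩ := hSne
    obtain ⟨k, hk⟩ : ((G.neighborFinset i).erase j).Nonempty := Finset.card_pos.1 (by omega)
    have h1 := hFfar k hk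
    have h2 := hFS k' hk'
    simp only [hS, Finset.mem_erase, SimpleGraph.mem_neighborFinset] at hk hk'
    have h3 := hlip k i hk.2.symm
    rw [geodesic_comm, hi k hk.2] at h3
    have h4 := hlip j k' hk'.2
    rw [hj k' hk'.2] at h4
    linarith
  have hsumi : F j + 6 * c ≤ ∑ k ∈ G.neighborFinset i, F k := by
    rw [← Finset.add_sum_erase _ _ hjN]
    have := Finset.card_nsmul_le_sum _ F _ hFfar
    rw [hcardi, nsmul_eq_mul] at this
    push_cast at this
    linarith
  have hsumj : ∑ k ∈ G.neighborFinset j, F k = F i := by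
    rw [← Finset.add_sum_erase _ _ hiN, Finset.sum_eq_zero hFS, add_zero]
  refine curvature_le hi0 hj0 h fun t ht0 ht q hq => le_trans ?_ (potential_le_cost hlip hq)
  rw [Finset.sum_congr rfl fun k hk => by
      rw [stepWeight_eq_of_const hc hdi hi (by simpa using hk)],
    Finset.sum_congr (s₁ := G.neighborFinset j) rfl fun k hk => by
      rw [stepWeight_eq_of_const hc hdj hj (by simpa using hk)],
    ← Finset.mul_sum, ← Finset.mul_sum, hsumj, hi j h]
  -- The dual value is at least `(1 - 4t/3)(F i - F j) + 2tc`, and so at least `c (1 + 2t/3)`.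
  nlinarith [mul_le_mul_of_nonneg_left hsumi ht0.le,
    mul_le_mul_of_nonneg_left hFij (show (0 : ℝ) ≤ 1 - 4 / 3 * t by linarith)]

/-! ### The tree-action as a sum over vertices -/

/-- The sum equals `3 - c_v²/d_v`, and Cauchy–Schwarz over the three neighbours gives `c_v² ≤ 3
d_v`. -/
theorem sum_endpointCurvature_nonneg {v : V} (hdeg : G.degree v = 3)
    (hv : ∀ k, G.Adj v k → 0 < geodesic G ℓ v k) :
    0 ≤ ∑ k ∈ G.neighborFinset v, (endpointCurvature G ℓ v s(v, k) + 1 / 3) := by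
  obtain ⟨j, hj⟩ : ∃ j, G.Adj v j := by
    rw [← G.degree_pos_iff_exists_adj]
    omega
  have hd := invSqSum_pos hv hj
  have hcs : invSum G ℓ v ^ 2 ≤ 3 * invSqSum G ℓ v := by
    have := sq_sum_le_card_mul_sum_sq (s := G.neighborFinset v)
      (f := fun k => 1 / geodesic G ℓ v k)
    rw [SimpleGraph.card_neighborFinset_eq_degree, hdeg] at this
    simp only [one_div, inv_pow] at this
    simpa [invSum_eq_sum, invSqSum_eq_sum] using this
  have h1 : ∑ k ∈ G.neighborFinset v, (endpointCurvature G ℓ v s(v, k) + 1 / 3)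
      = 2 * invSqSum G ℓ v / invSqSum G ℓ v - invSum G ℓ v * invSum G ℓ v / invSqSum G ℓ v
        + 1 := by
    simp only [endpointCurvature, edgeGeodesic, Sym2.lift_mk, Finset.sum_add_distrib,
      Finset.sum_sub_distrib, Finset.sum_const, SimpleGraph.card_neighborFinset_eq_degree, hdeg,
      ← Finset.sum_div, ← Finset.sum_mul, ← Finset.mul_sum, ← invSum_eq_sum]
    simp only [one_div_pow, ← invSqSum_eq_sum]
    norm_num
  rw [h1, mul_div_cancel_right₀ _ hd.ne']
  have := (div_le_iff₀ hd).2 hcs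
  rw [← pow_two]
  linarith

theorem endpointCurvature_eq_of_const {c : ℝ} (hc : 0 < c) {v k : V} (hdeg : G.degree v = 3)
    (hv : ∀ k, G.Adj v k → geodesic G ℓ v k = c) (h : G.Adj v k) :
    endpointCurvature G ℓ v s(v, k) = -(1 / 3) := by
  simp only [endpointCurvature, edgeGeodesic, Sym2.lift_mk]
  rw [invSum_eq_of_const hv, invSqSum_eq_of_const hv, hdeg, hv k h]
  push_cast
  field_simp
  norm_num

/-- If at each vertex of a finite region of a cubic graph either all edges belong to the region
or all geodesic lengths agree with `c`, then the tree-action is at least what it is for constant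
geodesic lengths. -/
theorem le_treeAction (hdeg : ∀ v, G.degree v = 3) {R : G.Subgraph} (hfin : R.verts.Finite)
    (hpos : PositiveNear R ℓ) {c : ℝ} (hc : 0 < c)
    (hR : ∀ v ∈ R.verts, (∀ k, G.Adj v k → R.Adj v k) ∨ ∀ k, G.Adj v k → geodesic G ℓ v k = c) :
    ∑ᶠ e ∈ R.edgeSet, (-(2 / 3) : ℝ) ≤ treeAction R ℓ := by
  classical
  have hE := finite_edgeSet_of_finite_verts hfin
  rw [treeAction, finsum_mem_eq_finite_toFinset_sum _ hE, finsum_mem_eq_finite_toFinset_sum _ hE,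
    ← sub_nonneg, ← Finset.sum_sub_distrib]
  -- The excess over `-2/3` is shared between the two endpoints, each taking one `1/3`.
  have h1 : ∀ e ∈ hE.toFinset, treeCurvature G ℓ e - -(2 / 3)
      = ∑ v ∈ hfin.toFinset, if v ∈ e then endpointCurvature G ℓ v e + 1 / 3 else 0 := by
    intro e he
    induction e with
    | h a b =>
      rw [Set.Finite.mem_toFinset, SimpleGraph.Subgraph.mem_edgeSet] at he
      have hsub : ({a, b} : Finset V) ⊆ hfin.toFinset := by
        simp [Set.insert_subset_iff, he.fst_mem, he.snd_mem]
      rw [← Finset.sum_subset hsub fun v _ hv => by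
        rw [if_neg]; simpa using hv]
      rw [Finset.sum_pair he.ne, treeCurvature_eq_add]
      simp
      ring
  rw [Finset.sum_congr rfl h1, Finset.sum_comm]
  refine Finset.sum_nonneg fun v hv => ?_
  rw [Set.Finite.mem_toFinset] at hv
  rcases hR v hv with hall | hconst
  · refine (sum_endpointCurvature_nonneg (hdeg v) (hpos v hv)).trans_eq ?_
    rw [← Finset.sum_filter]
    refine Finset.sum_bij (fun k _ => s(v, k)) ?_ ?_ ?_ ?_
    · intro k hk
      simpa using hall k (by simpa using hk)
    · intro k _ k' _ h
      exact Sym2.congr_right.1 h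
    · intro e he
      simp only [Finset.mem_filter, Set.Finite.mem_toFinset] at he
      obtain ⟨k, rfl⟩ := Sym2.mem_iff_exists.1 he.2
      exact ⟨k, by simpa using (SimpleGraph.Subgraph.mem_edgeSet.1 he.1).adj_sub, rfl⟩
    · intros
      rfl
  -- Here every incident term is zero, so it does not matter which edges at `v` are missing from the
  -- region.
  · refine Finset.sum_nonneg fun e he => ?_
    split_ifs with hve
    · obtain ⟨k, rfl⟩ := Sym2.mem_iff_exists.1 hve
      rw [Set.Finite.mem_toFinset, SimpleGraph.Subgraph.mem_edgeSet] at he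
      rw [endpointCurvature_eq_of_const hc (hdeg v) hconst he.adj_sub]
      norm_num
    · exact le_rfl

theorem treeAction_le_action {R : G.Subgraph} (hfin : R.verts.Finite) (hpos : PositiveNear R ℓ) :
    treeAction R ℓ ≤ action R ℓ := by
  have hE := finite_edgeSet_of_finite_verts hfin
  rw [treeAction, action, finsum_mem_eq_finite_toFinset_sum _ hE,
    finsum_mem_eq_finite_toFinset_sum _ hE]
  refine Finset.sum_le_sum fun e he => ?_
  induction e with
  | h a b =>
    rw [Set.Finite.mem_toFinset, SimpleGraph.Subgraph.mem_edgeSet] at he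
    exact treeCurvature_le_curvature (hpos a he.fst_mem) (hpos b he.snd_mem) he.adj_sub

end LocallyFinite

end Graph

/-! ### The strong constant boundary condition -/

section Boundary

variable {V : Type*} {G : SimpleGraph V} {ℓ : Sym2 V → ℝ≥0} {R : G.Subgraph} {B : Set V}
  {c : ℝ≥0} {i k x y : V}

theorem subset_withinStep {F : Set (Sym2 V)} (hF : F ⊆ G.edgeSet) : F ⊆ withinStep G F :=
  fun e he => ⟨hF he, e, he, by
    induction e with
    | h a b => exact ⟨a, by simp⟩⟩

theorem withinStep_subset (F : Set (Sym2 V)) : withinStep G F ⊆ G.edgeSet := fun _ h => h.1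

theorem mem_withinStep_of_adj {F : Set (Sym2 V)} (he : s(i, k) ∈ F) (h : G.Adj k x) :
    s(k, x) ∈ withinStep G F :=
  ⟨h, _, he, k, by simp⟩

theorem StrongBoundary.eq_of_mem (h : StrongBoundary R B c ℓ) {e : Sym2 V}
    (he : e ∈ withinStep G (boundaryEdges R B)) : ℓ e = c :=
  h e (subset_withinStep (withinStep_subset _) he)

/-- At a vertex of the region, either all edges belong to the region, or all edges are near the
boundary. -/
theorem adj_or_mem_withinStep (hB : ∀ i ∈ R.verts, i ∉ B → ∀ j, G.Adj i j → R.Adj i j)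
    (hi : i ∈ R.verts) :
    (∀ k, G.Adj i k → R.Adj i k) ∨
      ∀ k, G.Adj i k → s(i, k) ∈ withinStep G (boundaryEdges R B) := by
  by_cases hiB : i ∈ B
  · by_cases h : ∃ w, G.Adj i w ∧ (w ∈ B ∨ w ∉ R.verts)
    · obtain ⟨w, hw, hwB⟩ := h
      have hm : s(w, i) ∈ boundaryEdges R B := ⟨i, w, Sym2.eq_swap, hw, hiB, hwB⟩
      exact Or.inr fun k hk => mem_withinStep_of_adj hm hk
    -- All neighbours of `i` are now in the region and outside `B`, so each edge at `i` lies in the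
    -- region by `hB` applied at its other end.
    · push Not at h
      exact Or.inl fun k hk => (hB k (h k hk).2 (h k hk).1 i hk.symm).symm
  · exact Or.inl (hB i hi hiB)

theorem mem_boundaryEdges_of_notMem (hBd : IsBoundary R B) (hi : i ∈ R.verts) (h : G.Adj i k)
    (hk : k ∉ R.verts) : s(i, k) ∈ boundaryEdges R B :=
  ⟨i, k, rfl, h, hBd.2 i hi ⟨k, h, hk⟩, Or.inr hk⟩

theorem length_eq_of_mem (hB : ∀ i ∈ R.verts, i ∉ B → ∀ j, G.Adj i j → R.Adj i j)
    (hℓ : StrongBoundary R B c ℓ) (hR : ∀ e ∈ R.edgeSet, ℓ e = c) (hi : i ∈ R.verts)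
    (h : G.Adj i k) : ℓ s(i, k) = c := by
  rcases adj_or_mem_withinStep hB hi with h' | h'
  · exact hR _ (h' k h)
  · exact hℓ.eq_of_mem (h' k h)

theorem length_eq_of_adj (hBd : IsBoundary R B)
    (hB : ∀ i ∈ R.verts, i ∉ B → ∀ j, G.Adj i j → R.Adj i j)
    (hℓ : StrongBoundary R B c ℓ) (hR : ∀ e ∈ R.edgeSet, ℓ e = c) (hi : i ∈ R.verts)
    (h : G.Adj i k) (hkx : G.Adj k x) : ℓ s(k, x) = c := by
  by_cases hk : k ∈ R.verts
  · exact length_eq_of_mem hB hℓ hR hk hkx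
  · exact hℓ.eq_of_mem (mem_withinStep_of_adj (mem_boundaryEdges_of_notMem hBd hi h hk) hkx)

/-- If the walk leaves the region at its first step, that step is an edge of `E(∂Σ)` and the third
edge is at most two steps away. This is where the second step of the boundary condition is used. -/
theorem length_eq_of_adj_adj (hBd : IsBoundary R B)
    (hB : ∀ i ∈ R.verts, i ∉ B → ∀ j, G.Adj i j → R.Adj i j)
    (hℓ : StrongBoundary R B c ℓ) (hR : ∀ e ∈ R.edgeSet, ℓ e = c) (hi : i ∈ R.verts)
    (h : G.Adj i k) (hkx : G.Adj k x) (hxy : G.Adj x y) : ℓ s(x, y) = c := by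
  by_cases hk : k ∈ R.verts
  · exact length_eq_of_adj hBd hB hℓ hR hk hkx hxy
  · exact hℓ _ (mem_withinStep_of_adj
      (mem_withinStep_of_adj (mem_boundaryEdges_of_notMem hBd hi h hk) hkx) hxy)

theorem _root_.SimpleGraph.Subgraph.Connected.exists_adj {v e₁ e₂ : V} (hR : R.Connected)
    (he : R.Adj e₁ e₂) (hv : v ∈ R.verts) : ∃ w, R.Adj v w := by
  by_cases h : v = e₁
  · exact ⟨e₂, h ▸ he⟩
  · obtain ⟨p⟩ := hR.coe.preconnected ⟨v, hv⟩ ⟨e₁, he.fst_mem⟩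
    cases p with
    | nil => exact absurd rfl h
    | cons h' _ => exact ⟨_, h'⟩

theorem positiveNear_const (hc : 0 < c) : PositiveNear R (fun _ => c) := fun i _ j h => by
  rw [geodesic_eq_of_start (fun _ _ => rfl) h]
  exact_mod_cast hc

theorem strongBoundary_const : StrongBoundary R B c (fun _ => c) := fun _ _ => rfl

end Boundary

/-! ### The hexagonal lattice -/

/-- The neighbours of a vertex of the hexagonal lattice. -/
def hexNeighbors : ℤ × ℤ × Bool → Finset (ℤ × ℤ × Bool)
  | (x, y, false) => {(x, y, true), (x - 1, y, true), (x, y - 1, true)}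
  | (x, y, true) => {(x, y, false), (x + 1, y, false), (x, y + 1, false)}

theorem mem_hexNeighbors (u v : ℤ × ℤ × Bool) : v ∈ hexNeighbors u ↔ hexLattice.Adj u v := by
  obtain ⟨x, y, b⟩ := u
  obtain ⟨z, w, d⟩ := v
  cases b <;> cases d <;> simp [hexNeighbors, hexLattice, hexBond]
  omega

theorem card_hexNeighbors (u : ℤ × ℤ × Bool) : (hexNeighbors u).card = 3 := by
  obtain ⟨x, y, b⟩ := u
  cases b <;> exact Finset.card_eq_three.2 ⟨_, _, _, by simp [eq_sub_iff_add_eq],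
    by simp [eq_sub_iff_add_eq], by simp, rfl⟩

instance : hexLattice.LocallyFinite := fun u =>
  Fintype.ofFinset (hexNeighbors u) fun v => mem_hexNeighbors u v

theorem hexLattice_degree (u : ℤ × ℤ × Bool) : hexLattice.degree u = 3 := by
  rw [← card_hexNeighbors u, ← SimpleGraph.card_neighborFinset_eq_degree]
  congr 1
  ext v
  rw [SimpleGraph.mem_neighborFinset, mem_hexNeighbors]

theorem hexLattice_color_ne {u v : ℤ × ℤ × Bool} (h : hexLattice.Adj u v) : v.2.2 = !u.2.2 := by
  rcases h with h | h <;> simp [h.1, h.2.1]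

/-- The hexagonal lattice has no cycles of length four. -/
theorem hexLattice_squareFree {k i j l : ℤ × ℤ × Bool} (hki : hexLattice.Adj k i)
    (hij : hexLattice.Adj i j) (hjl : hexLattice.Adj j l) (hkj : k ≠ j) (hil : l ≠ i) :
    ¬ hexLattice.Adj k l := by
  intro hkl
  obtain ⟨k1, k2, k3⟩ := k
  obtain ⟨i1, i2, i3⟩ := i
  obtain ⟨j1, j2, j3⟩ := j
  obtain ⟨l1, l2, l3⟩ := l
  cases k3 <;> cases i3 <;> cases j3 <;> cases l3 <;>
    simp [hexLattice, hexBond] at hki hij hjl hkl hkj hil <;> omega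

/-- A finite nonempty set of vertices has a neighbour outside. -/
theorem exists_hexLattice_adj_notMem {S : Set (ℤ × ℤ × Bool)} (hS : S.Finite)
    (hne : S.Nonempty) : ∃ v ∈ S, ∃ w, hexLattice.Adj v w ∧ w ∉ S := by
  -- Every vertex has a neighbour with a smaller value of this height, so a minimiser has a
  -- neighbour outside `S`.
  obtain ⟨v, hv, hmin⟩ := Set.exists_min_image S
    (fun v => 2 * v.1 + if v.2.2 then 1 else 0) hS hne
  refine ⟨v, hv, ?_⟩
  obtain ⟨x, y, b⟩ := v
  cases b
  · refine ⟨(x - 1, y, true), by simp [hexLattice, hexBond], fun h => ?_⟩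
    have := hmin _ h
    simp at this
    omega
  · refine ⟨(x, y, false), by simp [hexLattice, hexBond], fun h => ?_⟩
    have := hmin _ h
    simp at this

variable {ℓ : Sym2 (ℤ × ℤ × Bool) → ℝ≥0} {R : hexLattice.Subgraph} {B : Set (ℤ × ℤ × Bool)}
  {c : ℝ≥0}

/-- The neighbours of the two ends of an edge are at distance three. -/
theorem three_mul_le_geodesic {i j k l : ℤ × ℤ × Bool} (hij : hexLattice.Adj i j)
    (hik : hexLattice.Adj i k) (hkj : k ≠ j) (hjl : hexLattice.Adj j l) (hli : l ≠ i)
    (hk : ∀ x, hexLattice.Adj k x → ℓ s(k, x) = c)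
    (hx : ∀ x y, hexLattice.Adj k x → hexLattice.Adj x y → ℓ s(x, y) = c)
    (hl : ∀ x, hexLattice.Adj l x → ℓ s(l, x) = c) :
    3 * (c : ℝ) ≤ geodesic hexLattice ℓ k l := by
  have hcolor : l.2.2 = !k.2.2 := by
    rw [hexLattice_color_ne hjl, hexLattice_color_ne hij, hexLattice_color_ne hik]
  refine le_geodesic ((hik.symm.reachable.trans hij.reachable).trans hjl.reachable) fun p => ?_
  -- The colours exclude walks with zero or two edges, and square-freeness excludes one edge.
  -- Otherwise the first two edges have length `c`, and the rest, ending at `l`, is at least `c`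
  -- long.
  cases p with
  | nil => simp at hcolor
  | cons h p =>
    cases p with
    | nil => exact absurd h (hexLattice_squareFree hik.symm hij hjl hkj hli)
    | @cons _ x _ h' p =>
      have hxl : x ≠ l := by
        rintro rfl
        rw [hexLattice_color_ne h', hexLattice_color_ne h] at hcolor
        simp at hcolor
      rw [walkLength_cons, walkLength_cons, hk _ h, hx _ _ h h']
      linarith [le_walkLength_of_end hl hxl p]

/-- A finite region has a vertex with an outside neighbour. Once the region has an edge,
connectedness gives one at that vertex, and the boundary condition forces its length to be `c`. -/
theorem length_eq_of_const (hconn : R.Connected) (hfin : R.verts.Finite) (hBd : IsBoundary R B)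
    (hℓ : StrongBoundary R B c ℓ) (ha : ∃ a, ∀ e ∈ R.edgeSet, ℓ e = a) :
    ∀ e ∈ R.edgeSet, ℓ e = c := by
  obtain ⟨a, ha⟩ := ha
  intro e he
  induction e with
  | h e₁ e₂ =>
    obtain ⟨v, hv, w, hvw, hw⟩ := exists_hexLattice_adj_notMem hfin hconn.nonempty
    obtain ⟨u, hu⟩ := hconn.exists_adj he hv
    have h1 := mem_boundaryEdges_of_notMem hBd hv hvw hw
    rw [Sym2.eq_swap] at h1
    rw [ha _ he, ← ha s(v, u) hu, hℓ.eq_of_mem (mem_withinStep_of_adj h1 hu.adj_sub)]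

theorem curvature_eq_treeCurvature (hc : 0 < c) (hBd : IsBoundary R B)
    (hB : ∀ i ∈ R.verts, i ∉ B → ∀ j, hexLattice.Adj i j → R.Adj i j)
    (hℓ : StrongBoundary R B c ℓ) (hR : ∀ e ∈ R.edgeSet, ℓ e = c) {e : Sym2 (ℤ × ℤ × Bool)}
    (he : e ∈ R.edgeSet) :
    curvature hexLattice ℓ e = treeCurvature hexLattice ℓ e ∧
      treeCurvature hexLattice ℓ e = -(2 / 3) := by
  have hP : ∀ v ∈ R.verts, ∀ k, hexLattice.Adj v k → geodesic hexLattice ℓ v k = c :=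
    fun v hv k hk => geodesic_eq_of_start (fun x hx => length_eq_of_mem hB hℓ hR hv hx) hk
  have hc' : (0 : ℝ) < c := by exact_mod_cast hc
  induction e with
  | h i j =>
    have hij : R.Adj i j := he
    have hi := hij.fst_mem
    have hj := hij.snd_mem
    refine ⟨curvature_eq_of_const hc' (hexLattice_degree i) (hexLattice_degree j) (hP i hi)
      (hP j hj) hij.adj_sub fun k l hik hkj hjl hli => ?_,
      treeCurvature_eq_of_const hc' (hexLattice_degree i) (hexLattice_degree j) (hP i hi)
        (hP j hj) hij.adj_sub⟩
    exact three_mul_le_geodesic hij.adj_sub hik hkj hjl hli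
      (fun x hx => length_eq_of_adj hBd hB hℓ hR hi hik hx)
      (fun x y hx hy => length_eq_of_adj_adj hBd hB hℓ hR hi hik hx hy)
      (fun x hx => length_eq_of_adj hBd hB hℓ hR hj hjl hx)

theorem le_action_of_strongBoundary (hfin : R.verts.Finite) (hc : 0 < c)
    (hB : ∀ i ∈ R.verts, i ∉ B → ∀ j, hexLattice.Adj i j → R.Adj i j)
    (hpos : PositiveNear R ℓ) (hℓ : StrongBoundary R B c ℓ) :
    ∑ᶠ e ∈ R.edgeSet, (-(2 / 3) : ℝ) ≤ action R ℓ := by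
  refine (le_treeAction hexLattice_degree hfin hpos (c := c) (by exact_mod_cast hc)
    fun v hv => ?_).trans (treeAction_le_action hfin hpos)
  refine (adj_or_mem_withinStep hB hv).imp_right fun h k hk => ?_
  exact geodesic_eq_of_start (fun x hx => hℓ.eq_of_mem (h x hx)) hk

end LinLuYau

/-! ### Curvature bound and minimality of constant lengths -/

theorem mainTheorem9 (R : hexLattice.Subgraph) (hconn : R.Connected) (hfin : R.verts.Finite) :
    (∀ ℓ : Sym2 (ℤ × ℤ × Bool) → ℝ≥0, PositiveNear R ℓ →
      (∀ i j, R.Adj i j →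
        Tendsto (fun t : ℝ => 1 / t * curvatureAt hexLattice ℓ t i j) (𝓝[>] 0)
          (𝓝 (curvature hexLattice ℓ s(i, j)))) ∧
      treeAction R ℓ ≤ action R ℓ) ∧
    (∀ B : Set (ℤ × ℤ × Bool), IsBoundary R B →
      (∀ i ∈ R.verts, i ∉ B → ∀ j, hexLattice.Adj i j → R.Adj i j) →
      ∀ c : ℝ≥0, 0 < c →
        (PositiveNear R (fun _ => c) ∧ StrongBoundary R B c (fun _ => c)) ∧
        ∀ ℓ₀ : Sym2 (ℤ × ℤ × Bool) → ℝ≥0, PositiveNear R ℓ₀ → StrongBoundary R B c ℓ₀ →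
          (∃ a, ∀ e ∈ R.edgeSet, ℓ₀ e = a) →
          (∀ e ∈ R.edgeSet, curvature hexLattice ℓ₀ e = treeCurvature hexLattice ℓ₀ e) ∧
          IsLeast (action R '' {ℓ | PositiveNear R ℓ ∧ StrongBoundary R B c ℓ})
            (action R ℓ₀)) := by
  refine ⟨fun ℓ hpos => ⟨fun i j h => tendsto_curvatureAt (hpos i h.fst_mem) (hpos j h.snd_mem)
    h.adj_sub, treeAction_le_action hfin hpos⟩, fun B hBd hB c hc =>
    ⟨⟨positiveNear_const hc, strongBoundary_const⟩, fun ℓ₀ hpos₀ hℓ₀ ha => ?_⟩⟩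
  have hR := length_eq_of_const hconn hfin hBd hℓ₀ ha
  refine ⟨fun e he => (curvature_eq_treeCurvature hc hBd hB hℓ₀ hR he).1,
    ⟨ℓ₀, ⟨hpos₀, hℓ₀⟩, rfl⟩, ?_⟩
  rintro _ ⟨ℓ, ⟨hpos, hℓ⟩, rfl⟩
  -- At `ℓ₀` every edge of the region has curvature `-2/3`, so its action equals the lower bound.
  refine le_of_eq_of_le ?_ (le_action_of_strongBoundary hfin hc hB hpos hℓ)
  refine finsum_mem_congr rfl fun e he => ?_
  obtain ⟨h1, h2⟩ := curvature_eq_treeCurvature hc hBd hB hℓ₀ hR he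
  rw [h1, h2]
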